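/- Let $\mathcal C$ be an exact Goursat category, i.e. a finitely complete regular category in which every internal equivalence relation is effective (the kernel pair of some morphism) and in which $R\circ S\circ R=S\circ R\circ S$ for all equivalence relations $R,S$ on a same object. Let $\mathcal L$ be a Birkhoff subcategory of $\mathcal C$: a full replete reflective subcategory $\iota\colon\mathcal L\hookrightarrow\mathcal C$, with reflector $\lambda$, such that every component $\eta_X\colon X\to\iota\lambda(X)$ of the unit is a regular epimorphism, and such that $Y\in\mathcal L$ whenever there is a regular epimorphism $X\to Y$ with $X\in\mathcal L$. For an equivalence relation $S$ on $X$ with quotient $q\colon X\to X/S$, its closure $\overline S$ is the kernel pair of $\eta_{X/S}\circ q$, i.e. the inverse image along $q$ of the kernel pair of $\eta_{X/S}$. Equivalence relations on $X$ are ordered as subobjects of $X\times X$, $\vee$ denotes the join (least upper bound) in the poset of equivalence relations, and $f(R)$ denotes the regular image of $R$ along $f$, i.e. the image of $R\to X\times X\xrightarrow{f\times f}Y\times Y$. Then: 1. For every regular epimorphism $f\colon X\to Y$ in $\mathcal C$ and all equivalence relations $R,S$ on $X$, the join $R\vee S$ exists, the regular images $f(R)$, $f(S)$, $f(R\vee S)$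 are equivalence relations on $Y$, the join $\overline{f(R)}\vee\overline{f(S)}$ exists, and $$\overline{f(R\vee S)}=\overline{f(R)}\vee\overline{f(S)}.$$ 2. For all equivalence relations $R,S$ on an object $X$ of $\mathcal C$, the joins $R\vee S$ and $\overline R\vee\overline S$ exist, and $$\overline{R\vee S}=\overline R\vee\overline S.$$ -/

import Mathlib

open CategoryTheory CategoryTheory.Limits

universe v u

noncomputable section

namespace GoursatClosure

/-- An *exact category* (in the sense of Barr): a finitely complete regular category in which every
internal equivalence relation is effective, i.e. is the kernel pair of some morphism. -/
class Exact (C : Type u) [Category.{v} C] : Prop extends Regular C where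
  effective : ∀ {R X : C} (p₁ p₂ : R ⟶ X), IsEquivalenceRelation p₁ p₂ →
    ∃ (Y : C) (f : X ⟶ Y), IsKernelPair f p₁ p₂

section Relations

variable {C : Type u} [Category.{v} C] [Regular C]

/-- First projection of a relation `R` on `X`, where a relation is a subobject of `X ⨯ X`. -/
abbrev proj₁ {X : C} (R : Subobject (X ⨯ X)) : (R : C) ⟶ X := R.arrow ≫ prod.fst

/-- Second projection of a relation on `X`. -/
abbrev proj₂ {X : C} (R : Subobject (X ⨯ X)) : (R : C) ⟶ X := R.arrow ≫ prod.snd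

/-- Relational composition: the image in `X ⨯ X` of the object of triples
`x R y S z`, sent to `(x, z)`. -/
def relComp {X : C} (R S : Subobject (X ⨯ X)) : Subobject (X ⨯ X) :=
  imageSubobject (prod.lift
    (pullback.fst (proj₂ R) (proj₁ S) ≫ proj₁ R)
    (pullback.snd (proj₂ R) (proj₁ S) ≫ proj₂ S))

/-- The regular image `f(R)` of a relation `R` on `X` along `f : X ⟶ Y`: the image of
`R ⟶ X ⨯ X ⟶ Y ⨯ Y`. -/
def regularImage {X Y : C} (f : X ⟶ Y) (R : Subobject (X ⨯ X)) : Subobject (Y ⨯ Y) :=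
  imageSubobject (R.arrow ≫ prod.map f f)

/-- The poset of (internal) equivalence relations on `X`, ordered by inclusion of subobjects of
`X ⨯ X`. -/
abbrev EquivRel (X : C) : Type (max u v) :=
  { R : Subobject (X ⨯ X) // IsEquivalenceRelation (proj₁ R) (proj₂ R) }

instance mono_kernelPair {X Y : C} (f : X ⟶ Y) :
    Mono (prod.lift (pullback.fst f f) (pullback.snd f f)) where
  right_cancellation g h w := by
    apply pullback.hom_ext
    · have h1 := congrArg (fun k => k ≫ prod.fst) w
      simpa only [Category.assoc, prod.lift_fst] using h1
    · have h2 := congrArg (fun k => k ≫ prod.snd) w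
      simpa only [Category.assoc, prod.lift_snd] using h2

theorem isKernelPair_mk {X Y : C} (f : X ⟶ Y) :
    IsKernelPair f
      (proj₁ (Subobject.mk (prod.lift (pullback.fst f f) (pullback.snd f f))))
      (proj₂ (Subobject.mk (prod.lift (pullback.fst f f) (pullback.snd f f)))) := by
  have h₁ : proj₁ (Subobject.mk (prod.lift (pullback.fst f f) (pullback.snd f f))) =
      (Subobject.underlyingIso _).hom ≫ pullback.fst f f := by
    rw [proj₁, ← Subobject.underlyingIso_hom_comp_eq_mk, Category.assoc, prod.lift_fst]
  have h₂ : proj₂ (Subobject.mk (prod.lift (pullback.fst f f) (pullback.snd f f))) =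
      (Subobject.underlyingIso _).hom ≫ pullback.snd f f := by
    rw [proj₂, ← Subobject.underlyingIso_hom_comp_eq_mk, Category.assoc, prod.lift_snd]
  exact IsPullback.of_iso_pullback ⟨by rw [h₁, h₂]; simp [pullback.condition]⟩
    (Subobject.underlyingIso _) h₁.symm h₂.symm

/-- The kernel pair `R[f]` of `f : X ⟶ Y`, as an equivalence relation on `X`. -/
def kernelPair {X Y : C} (f : X ⟶ Y) : EquivRel X :=
  ⟨Subobject.mk (prod.lift (pullback.fst f f) (pullback.snd f f)),
    ⟨⟨IsKernelPair.equivalenceRelation f _ _ (pullbackIsPullback _ _) (isKernelPair_mk f)⟩⟩⟩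

variable (C) in
/-- The *Goursat* (3-permutability) condition: `R ∘ S ∘ R = S ∘ R ∘ S` for all equivalence relations
`R`, `S` on a same object. -/
class Goursat : Prop where
  comp_comp : ∀ {X : C} (R S : EquivRel X),
    relComp (relComp R.1 S.1) R.1 = relComp (relComp S.1 R.1) S.1

end Relations

section Subcategories

variable {C : Type u} [Category.{v} C]

/-- A full reflective subcategory (given by the property `L` of its objects) is *epireflective* when
it is replete and all components of the unit of the reflection are regular epimorphisms. -/
structure IsEpireflective (L : ObjectProperty C) [Reflective L.ι] : Prop where
  replete : L.IsClosedUnderIsomorphisms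
  unit_regularEpi : ∀ X : C, IsRegularEpi ((reflectorAdjunction L.ι).unit.app X)

/-- A *Birkhoff subcategory*: an epireflective subcategory closed under regular quotients. -/
structure IsBirkhoff (L : ObjectProperty C) [Reflective L.ι] : Prop extends
    IsEpireflective L where
  quotient : ∀ {X Y : C} (f : X ⟶ Y), IsRegularEpi f → L X → L Y

end Subcategories

section Closure

variable {C : Type u} [Category.{v} C] [Exact C]

instance hasCoequalizer_equivRel {X : C} (S : EquivRel X) :
    HasCoequalizer (proj₁ S.1) (proj₂ S.1) := by
  obtain ⟨_, _, h⟩ := Exact.effective _ _ S.2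
  exact Regular.hasCoequalizer_of_isKernelPair h

/-- The canonical quotient `q : X ⟶ X/S`: the coequalizer of the two projections of `S`. -/
abbrev quotientMap {X : C} (S : EquivRel X) : X ⟶ coequalizer (proj₁ S.1) (proj₂ S.1) :=
  coequalizer.π (proj₁ S.1) (proj₂ S.1)

/-- The closure of the equivalence relation `S` on `X` associated with the reflective subcategory
`L`: the kernel pair of `X ⟶ X/S ⟶ ιλ(X/S)`, the quotient map followed by the unit of the
reflection (equivalently, the inverse image along `q` of the kernel pair of the unit at `X/S`). -/
def closure (L : ObjectProperty C) [Reflective L.ι] {X : C} (S : EquivRel X) : EquivRel X :=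
  kernelPair (quotientMap S ≫ (reflectorAdjunction L.ι).unit.app _)

end Closure

end GoursatClosure

end

noncomputable section

namespace GoursatClosure

/-! ### Generalized elements and relations in a regular category -/

section Elements

variable {C : Type u} [Category.{v} C] [Regular C]

/-! The closure of `R` is the least equivalence relation `T ≥ R` whose quotient lies in `L`: any
such `T` contains it by the universal property of the reflection (`closure_le_of_le`). The Birkhoff
condition adds that every `T` above a closure has quotient in `L`, being a regular quotient of a
reflected object (`IsBirkhoff.quotient_of_closure_le`). Hence an upper bound of the closures of `R`
and `S` contains `R ∨ S`, has quotient in `L`, and so contains the closure of `R ∨ S`.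

The Goursat condition supplies the joins (`exists_isLUB`) and makes regular images equivalence
relations (`isEquivalenceRelation_regularImage`). Image is left adjoint to inverse image, so it
preserves joins (`isLUB_regularImage`), which reduces the statement along `f` to the one on `Y`. -/

/-- In a regular category, strong epimorphisms are regular. -/
theorem isRegularEpi_of_strongEpi {X Y : C} (f : X ⟶ Y) [StrongEpi f] : IsRegularEpi f :=
  have : ExtremalEpi f := inferInstance
  inferInstance

instance strongEpi_factorThruImageSubobject {X Y : C} (f : X ⟶ Y) :
    StrongEpi (factorThruImageSubobject f) := by
  unfold factorThruImageSubobject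
  infer_instance

/-- A generalized element factors through the image of `f` if and only if it lifts along `f`
after passing to a cover. -/
theorem imageSubobject_factors_iff {X Y T : C} (f : X ⟶ Y) (g : T ⟶ Y) :
    (imageSubobject f).Factors g ↔
      ∃ (T' : C) (e : T' ⟶ T) (h : T' ⟶ X), StrongEpi e ∧ h ≫ f = e ≫ g := by
  constructor
  · intro hg
    have := isRegularEpi_of_strongEpi (factorThruImageSubobject f)
    let k := (imageSubobject f).factorThru g hg
    refine ⟨_, pullback.snd (factorThruImageSubobject f) k,
      pullback.fst (factorThruImageSubobject f) k, inferInstance, ?_⟩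
    calc pullback.fst _ k ≫ f
        = (pullback.fst _ k ≫ factorThruImageSubobject f) ≫ (imageSubobject f).arrow := by simp
      _ = pullback.snd _ k ≫ g := by
        rw [pullback.condition, Category.assoc, Subobject.factorThru_arrow]
  · rintro ⟨T', e, h, _, w⟩
    have sq : CommSq (h ≫ factorThruImageSubobject f) e (imageSubobject f).arrow g :=
      ⟨by simpa using w⟩
    exact (Subobject.factors_iff _ _).2 ⟨sq.lift, sq.fac_right⟩

/-- Two generalized elements `x`, `y` of `X` are related by the relation `R`. -/
def Rel {X T : C} (R : Subobject (X ⨯ X)) (x y : T ⟶ X) : Prop :=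
  R.Factors (prod.lift x y)

theorem rel_iff {X T : C} {R : Subobject (X ⨯ X)} {x y : T ⟶ X} :
    Rel R x y ↔ ∃ r : T ⟶ (R : C), r ≫ proj₁ R = x ∧ r ≫ proj₂ R = y := by
  constructor
  · intro (h : R.Factors _)
    refine ⟨R.factorThru _ h, ?_, ?_⟩
    · rw [← Category.assoc, Subobject.factorThru_arrow, prod.lift_fst]
    · rw [← Category.assoc, Subobject.factorThru_arrow, prod.lift_snd]
  · rintro ⟨r, rfl, rfl⟩
    refine (Subobject.factors_iff _ _).2 ⟨r, ?_⟩
    change r ≫ R.arrow = _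
    ext <;> simp [prod.lift_fst, prod.lift_snd]

theorem rel_proj {X : C} (R : Subobject (X ⨯ X)) : Rel R (proj₁ R) (proj₂ R) :=
  rel_iff.2 ⟨𝟙 _, by simp, by simp⟩

theorem Rel.precomp {X T T' : C} {R : Subobject (X ⨯ X)} {x y : T ⟶ X} (h : Rel R x y)
    (e : T' ⟶ T) : Rel R (e ≫ x) (e ≫ y) := by
  obtain ⟨r, rfl, rfl⟩ := rel_iff.1 h
  exact rel_iff.2 ⟨e ≫ r, by simp, by simp⟩

/-- `R.arrow` is mono, so it has the lifting property against the cover `e`. Relations may therefore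
be tested locally, which discards the covers introduced by images. -/
theorem rel_of_strongEpi {X T T' : C} {R : Subobject (X ⨯ X)} {x y : T ⟶ X} (e : T' ⟶ T)
    [StrongEpi e] (h : Rel R (e ≫ x) (e ≫ y)) : Rel R x y := by
  obtain ⟨r, h₁, h₂⟩ := rel_iff.1 h
  have sq : CommSq r e R.arrow (prod.lift x y) :=
    ⟨by ext <;> simpa [prod.lift_fst, prod.lift_snd] using by assumption⟩
  exact (Subobject.factors_iff _ _).2 ⟨sq.lift, sq.fac_right⟩

theorem Rel.mono {X T : C} {R S : Subobject (X ⨯ X)} {x y : T ⟶ X} (h : Rel R x y) (hRS : R ≤ S) :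
    Rel S x y :=
  Subobject.factors_of_le _ hRS h

theorem le_of_rel_proj {X : C} {R S : Subobject (X ⨯ X)} (h : Rel S (proj₁ R) (proj₂ R)) :
    R ≤ S := by
  obtain ⟨r, h₁, h₂⟩ := rel_iff.1 h
  refine Subobject.le_of_comm r ?_
  ext <;> simpa using by assumption

theorem rel_relComp_iff {X T : C} {R S : Subobject (X ⨯ X)} {x z : T ⟶ X} :
    Rel (relComp R S) x z ↔ ∃ (T' : C) (e : T' ⟶ T) (y : T' ⟶ X), StrongEpi e ∧
      Rel R (e ≫ x) y ∧ Rel S y (e ≫ z) := by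
  rw [Rel, relComp, imageSubobject_factors_iff]
  constructor
  · rintro ⟨T', e, h, he, w⟩
    have w₁ := congrArg (· ≫ prod.fst) w
    have w₂ := congrArg (· ≫ prod.snd) w
    refine ⟨T', e, h ≫ pullback.fst (proj₂ R) (proj₁ S) ≫ proj₂ R, he,
      rel_iff.2 ⟨h ≫ pullback.fst (proj₂ R) (proj₁ S), ?_, ?_⟩,
      rel_iff.2 ⟨h ≫ pullback.snd (proj₂ R) (proj₁ S), ?_, ?_⟩⟩
    · simpa [prod.lift_fst] using w₁
    · simp
    · rw [Category.assoc, ← pullback.condition]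
    · simpa [prod.lift_snd] using w₂
  · rintro ⟨T', e, y, he, h₁, h₂⟩
    obtain ⟨r, hr₁, hr₂⟩ := rel_iff.1 h₁
    obtain ⟨s, hs₁, hs₂⟩ := rel_iff.1 h₂
    refine ⟨T', e, pullback.lift r s (hr₂.trans hs₁.symm), he, ?_⟩
    ext
    · simpa [prod.lift_fst, pullback.lift_fst_assoc] using hr₁
    · simpa [prod.lift_snd, pullback.lift_snd_assoc] using hs₂

theorem rel_relComp_relComp_iff {X T : C} {R S Q : Subobject (X ⨯ X)} {x z : T ⟶ X} :
    Rel (relComp (relComp R S) Q) x z ↔ ∃ (T' : C) (e : T' ⟶ T) (a b : T' ⟶ X), StrongEpi e ∧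
      Rel R (e ≫ x) a ∧ Rel S a b ∧ Rel Q b (e ≫ z) := by
  constructor
  · intro h
    obtain ⟨T₁, e₁, b, _, h₁, h₂⟩ := rel_relComp_iff.1 h
    obtain ⟨T₂, e₂, a, _, h₃, h₄⟩ := rel_relComp_iff.1 h₁
    refine ⟨T₂, e₂ ≫ e₁, a, e₂ ≫ b, strongEpi_comp _ _, ?_, h₄, ?_⟩
    · simpa using h₃
    · simpa using h₂.precomp e₂
  · rintro ⟨T', e, a, b, he, h₁, h₂, h₃⟩
    refine rel_relComp_iff.2 ⟨T', e, b, he, rel_relComp_iff.2 ⟨T', 𝟙 _, a, inferInstance, ?_, ?_⟩,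
      h₃⟩
    · simpa using h₁
    · simpa using h₂

theorem rel_regularImage_iff {X Y T : C} {f : X ⟶ Y} {R : Subobject (X ⨯ X)} {y z : T ⟶ Y} :
    Rel (regularImage f R) y z ↔ ∃ (T' : C) (e : T' ⟶ T) (a b : T' ⟶ X), StrongEpi e ∧
      Rel R a b ∧ a ≫ f = e ≫ y ∧ b ≫ f = e ≫ z := by
  rw [Rel, regularImage, imageSubobject_factors_iff]
  constructor
  · rintro ⟨T', e, h, he, w⟩
    have w₁ := congrArg (· ≫ prod.fst) w
    have w₂ := congrArg (· ≫ prod.snd) w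
    exact ⟨T', e, h ≫ proj₁ R, h ≫ proj₂ R, he, (rel_proj R).precomp h, by simpa [prod.lift_fst] using w₁,
      by simpa [prod.lift_snd] using w₂⟩
  · rintro ⟨T', e, a, b, he, h, h₁, h₂⟩
    obtain ⟨r, rfl, rfl⟩ := rel_iff.1 h
    refine ⟨T', e, r, he, ?_⟩
    ext
    · simpa [prod.lift_fst] using h₁
    · simpa [prod.lift_snd] using h₂

/-- The structure maps come from the universal elements: the projections of `R` for symmetry, those
of the pullback of composable pairs for transitivity. -/
theorem isEquivalenceRelation_of_rel {X : C} {R : Subobject (X ⨯ X)}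
    (hr : Rel R (𝟙 X) (𝟙 X))
    (hs : ∀ {T : C} {x y : T ⟶ X}, Rel R x y → Rel R y x)
    (ht : ∀ {T : C} {x y z : T ⟶ X}, Rel R x y → Rel R y z → Rel R x z) :
    IsEquivalenceRelation (proj₁ R) (proj₂ R) := by
  obtain ⟨r, hr₁, hr₂⟩ := rel_iff.1 hr
  obtain ⟨s, hs₁, hs₂⟩ := rel_iff.1 (hs (rel_proj R))
  have h₁ := (rel_proj R).precomp (pullback.fst (proj₂ R) (proj₁ R))
  have h₂ := (rel_proj R).precomp (pullback.snd (proj₂ R) (proj₁ R))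
  rw [← pullback.condition] at h₂
  obtain ⟨t, ht₁, ht₂⟩ := rel_iff.1 (ht h₁ h₂)
  refine ⟨⟨{
    right_cancellation := fun Z g h w₁ w₂ => ?_
    r := r
    reflexivity₁ := hr₁
    reflexivity₂ := hr₂
    s := s
    symmetry₁ := hs₁
    symmetry₂ := hs₂
    c := _
    isLimit := pullbackIsPullback _ _
    t := t
    transitivity₁ := ht₁
    transitivity₂ := ht₂ }⟩⟩
  rw [← cancel_mono R.arrow]
  ext
  · simpa [prod.lift_fst] using w₁
  · simpa [prod.lift_snd] using w₂

namespace EquivRel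

variable {X T : C} (R : EquivRel X)

theorem refl (x : T ⟶ X) : Rel R.1 x x := by
  obtain ⟨⟨h⟩⟩ := R.2
  exact rel_iff.2 ⟨x ≫ h.r, by rw [Category.assoc, h.reflexivity₁, Category.comp_id],
    by rw [Category.assoc, h.reflexivity₂, Category.comp_id]⟩

variable {R}

theorem symm {x y : T ⟶ X} (hxy : Rel R.1 x y) : Rel R.1 y x := by
  obtain ⟨⟨h⟩⟩ := R.2
  obtain ⟨r, rfl, rfl⟩ := rel_iff.1 hxy
  exact rel_iff.2 ⟨r ≫ h.s, by rw [Category.assoc, h.symmetry₁],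
    by rw [Category.assoc, h.symmetry₂]⟩

theorem trans {x y z : T ⟶ X} (hxy : Rel R.1 x y) (hyz : Rel R.1 y z) : Rel R.1 x z := by
  obtain ⟨⟨h⟩⟩ := R.2
  obtain ⟨r, rfl, hr⟩ := rel_iff.1 hxy
  obtain ⟨s, hs, rfl⟩ := rel_iff.1 hyz
  obtain ⟨l, hl₁, hl₂⟩ := PullbackCone.IsLimit.lift' h.isLimit r s (hr.trans hs.symm)
  refine rel_iff.2 ⟨l ≫ h.t, ?_, ?_⟩
  · rw [Category.assoc, h.transitivity₁, reassoc_of% hl₁]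
  · rw [Category.assoc, h.transitivity₂, reassoc_of% hl₂]

end EquivRel

theorem rel_kernelPair_iff {X Y T : C} {f : X ⟶ Y} {x y : T ⟶ X} :
    Rel (kernelPair f).1 x y ↔ x ≫ f = y ≫ f := by
  have hk : IsKernelPair f (proj₁ (kernelPair f).1) (proj₂ (kernelPair f).1) := isKernelPair_mk f
  constructor
  · intro h
    obtain ⟨r, rfl, rfl⟩ := rel_iff.1 h
    simp only [Category.assoc, hk.w]
  · intro w
    exact rel_iff.2 ⟨hk.lift x y w, hk.lift_fst x y w, hk.lift_snd x y w⟩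

theorem le_kernelPair_iff {X Y : C} {f : X ⟶ Y} {R : EquivRel X} :
    R ≤ kernelPair f ↔ proj₁ R.1 ≫ f = proj₂ R.1 ≫ f :=
  ⟨fun h => rel_kernelPair_iff.1 ((rel_proj R.1).mono h),
    fun h => le_of_rel_proj (rel_kernelPair_iff.2 h)⟩

/-- A morphism whose kernel pair contains that of a regular epimorphism `f` factors through `f`. -/
theorem exists_desc_of_kernelPair_le {X Y Z : C} (f : X ⟶ Y) [IsRegularEpi f] (g : X ⟶ Z)
    (h : kernelPair f ≤ kernelPair g) : ∃ k : Y ⟶ Z, f ≫ k = g :=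
  ⟨IsRegularEpi.desc f g (rel_kernelPair_iff.1
      ((rel_kernelPair_iff.2 (IsRegularEpi.w f)).mono h)), IsRegularEpi.fac f g _⟩

theorem regularImage_mono {X Y : C} (f : X ⟶ Y) {R S : Subobject (X ⨯ X)} (h : R ≤ S) :
    regularImage f R ≤ regularImage f S := by
  obtain ⟨T', e, a, b, he, hab, h₁, h₂⟩ := rel_regularImage_iff.1 (rel_proj (regularImage f R))
  exact le_of_rel_proj (rel_regularImage_iff.2 ⟨T', e, a, b, he, hab.mono h, h₁, h₂⟩)

/-- This is the adjunction between image and inverse image along `f`, since the inverse image of the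
kernel pair of `g` is that of `f ≫ g`. -/
theorem regularImage_le_kernelPair_iff {X Y Z : C} (f : X ⟶ Y) (g : Y ⟶ Z) (R : EquivRel X) :
    regularImage f R.1 ≤ (kernelPair g).1 ↔ R ≤ kernelPair (f ≫ g) := by
  constructor
  · intro h
    refine le_of_rel_proj (rel_kernelPair_iff.2 ?_)
    have := rel_kernelPair_iff.1 ((rel_regularImage_iff.2 ⟨_, 𝟙 _, _, _, inferInstance,
      rel_proj R.1, (Category.id_comp _).symm, (Category.id_comp _).symm⟩ :
        Rel (regularImage f R.1) _ _).mono h)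
    simpa using this
  · intro h
    obtain ⟨T', e, a, b, he, hab, h₁, h₂⟩ := rel_regularImage_iff.1 (rel_proj (regularImage f R.1))
    refine le_of_rel_proj (rel_of_strongEpi e (rel_kernelPair_iff.2 ?_))
    rw [← h₁, ← h₂]
    simpa using rel_kernelPair_iff.1 (hab.mono h)

end Elements

/-! ### Consequences of 3-permutability -/

section Joins

variable {C : Type u} [Category.{v} C] [Regular C] [Goursat C]

/-- In a Goursat category, `R ∘ S ∘ R` is an equivalence relation. -/
theorem isEquivalenceRelation_relComp {X : C} (R S : EquivRel X) :
    IsEquivalenceRelation (proj₁ (relComp (relComp R.1 S.1) R.1))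
      (proj₂ (relComp (relComp R.1 S.1) R.1)) := by
  refine isEquivalenceRelation_of_rel ?_ ?_ ?_
  · exact rel_relComp_relComp_iff.2 ⟨X, 𝟙 X, 𝟙 X, 𝟙 X, inferInstance,
      by simpa using R.refl (𝟙 X), S.refl _,
      by simpa using R.refl (𝟙 X)⟩
  · intro T x y h
    obtain ⟨T', e, a, b, he, h₁, h₂, h₃⟩ := rel_relComp_relComp_iff.1 h
    exact rel_relComp_relComp_iff.2 ⟨T', e, b, a, he, EquivRel.symm h₃, EquivRel.symm h₂,
      EquivRel.symm h₁⟩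
  · intro T x y z hxy hyz
    obtain ⟨T₁, e₁, a, b, _, h₁, h₂, h₃⟩ := rel_relComp_relComp_iff.1 hxy
    obtain ⟨T₂, e₂, c, d, _, h₄, h₅, h₆⟩ := rel_relComp_relComp_iff.1 (hyz.precomp e₁)
    -- In the chain `x R a S b R y R c S d R z`, the middle `a S b R c S d` becomes `R ∘ S ∘ R`,
    -- whose outer factors merge with the remaining `R`s.
    have had : Rel (relComp (relComp S.1 R.1) S.1) (e₂ ≫ a) d :=
      rel_relComp_relComp_iff.2 ⟨T₂, 𝟙 _, e₂ ≫ b, c, inferInstance,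
        by simpa using h₂.precomp e₂, EquivRel.trans (h₃.precomp e₂) h₄, by simpa using h₅⟩
    rw [← Goursat.comp_comp] at had
    obtain ⟨T₃, e₃, p, q, _, h₇, h₈, h₉⟩ := rel_relComp_relComp_iff.1 had
    refine rel_relComp_relComp_iff.2 ⟨T₃, e₃ ≫ e₂ ≫ e₁, p, q, inferInstance, ?_, h₈, ?_⟩
    · have := (h₁.precomp e₂).precomp e₃
      simpa using EquivRel.trans this h₇
    · have := h₆.precomp e₃
      simpa using EquivRel.trans h₉ this

/-- In a Goursat category, any two equivalence relations have a join, namely `R ∘ S ∘ R`. -/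
theorem exists_isLUB {X : C} (R S : EquivRel X) : ∃ J : EquivRel X, IsLUB {R, S} J := by
  refine ⟨⟨_, isEquivalenceRelation_relComp R S⟩, ?_, ?_⟩
  · rintro Q (rfl | rfl)
    · exact le_of_rel_proj (rel_relComp_relComp_iff.2 ⟨_, 𝟙 _, proj₁ Q.1, proj₁ Q.1, inferInstance,
        by simpa using Q.refl (proj₁ Q.1), S.refl _, by simpa using rel_proj Q.1⟩)
    · exact le_of_rel_proj (rel_relComp_relComp_iff.2 ⟨_, 𝟙 _, proj₁ Q.1, proj₂ Q.1, inferInstance,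
        by simpa using R.refl (proj₁ Q.1), rel_proj Q.1, by simpa using R.refl (proj₂ Q.1)⟩)
  · intro T hT
    obtain ⟨T', e, a, b, _, h₁, h₂, h₃⟩ := rel_relComp_relComp_iff.1
      (rel_proj (relComp (relComp R.1 S.1) R.1))
    have hR : R.1 ≤ T.1 := hT (Set.mem_insert _ _)
    have hS : S.1 ≤ T.1 := hT (Set.mem_insert_of_mem _ rfl)
    exact le_of_rel_proj (rel_of_strongEpi e
      (EquivRel.trans (EquivRel.trans (h₁.mono hR) (h₂.mono hS)) (h₃.mono hR)))

/-- In a Goursat category, equivalence relations are stable under regular images. -/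
theorem isEquivalenceRelation_regularImage {X Y : C} (f : X ⟶ Y) [IsRegularEpi f]
    (R : EquivRel X) :
    IsEquivalenceRelation (proj₁ (regularImage f R.1)) (proj₂ (regularImage f R.1)) := by
  refine isEquivalenceRelation_of_rel ?_ ?_ ?_
  · exact rel_regularImage_iff.2 ⟨X, f, 𝟙 X, 𝟙 X, inferInstance,
      by simpa using R.refl (𝟙 X), by simp, by simp⟩
  · intro T x y h
    obtain ⟨T', e, a, b, he, hab, h₁, h₂⟩ := rel_regularImage_iff.1 h
    exact rel_regularImage_iff.2 ⟨T', e, b, a, he, EquivRel.symm hab, h₂, h₁⟩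
  · intro T x y z hxy hyz
    obtain ⟨T₁, e₁, a, b, _, hab, h₁, h₂⟩ := rel_regularImage_iff.1 hxy
    obtain ⟨T₂, e₂, c, d, _, hcd, h₃, h₄⟩ := rel_regularImage_iff.1 (hyz.precomp e₁)
    -- Here `b` and `c` agree only after `f`. Permuting moves the kernel pair to both ends, where
    -- `f` erases it.
    have had : Rel (relComp (relComp R.1 (kernelPair f).1) R.1) (e₂ ≫ a) d :=
      rel_relComp_relComp_iff.2 ⟨T₂, 𝟙 _, e₂ ≫ b, c, inferInstance,
        by simpa using hab.precomp e₂, rel_kernelPair_iff.2 (by simp [h₂, h₃]), by simpa using hcd⟩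
    rw [Goursat.comp_comp] at had
    obtain ⟨T₃, e₃, p, q, _, h₅, h₆, h₇⟩ := rel_relComp_relComp_iff.1 had
    rw [rel_kernelPair_iff] at h₅ h₇
    refine rel_regularImage_iff.2 ⟨T₃, e₃ ≫ e₂ ≫ e₁, p, q, inferInstance, h₆, ?_, ?_⟩
    · rw [← h₅]
      simp [h₁]
    · rw [h₇]
      simp [h₄]

end Joins

/-! ### Effective quotients and the closure operator -/

section Closure

variable {C : Type u} [Category.{v} C] [Exact C]

/-- Effectiveness gives some `f` with kernel pair `S`; it factors through the quotient, so the
quotient identifies no more than `f` does. -/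
theorem kernelPair_quotientMap {X : C} (S : EquivRel X) : kernelPair (quotientMap S) = S := by
  obtain ⟨Y, f, hf⟩ := Exact.effective _ _ S.2
  refine le_antisymm (le_of_rel_proj ?_) (le_kernelPair_iff.2 (coequalizer.condition _ _))
  have w := rel_kernelPair_iff.1 (rel_proj (kernelPair (quotientMap S)).1)
  have w' := congrArg (· ≫ coequalizer.desc f hf.w) w
  simp only [Category.assoc, coequalizer.π_desc] at w'
  exact rel_iff.2 ⟨hf.lift _ _ (by simpa using w'), hf.lift_fst .., hf.lift_snd ..⟩

/-- Joins are preserved by regular images. -/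
theorem isLUB_regularImage {X Y : C} (f : X ⟶ Y) {R S J : EquivRel X} (h : IsLUB {R, S} J)
    {fR fS fJ : EquivRel Y} (hR : fR.1 = regularImage f R.1) (hS : fS.1 = regularImage f S.1)
    (hJ : fJ.1 = regularImage f J.1) : IsLUB {fR, fS} fJ := by
  constructor
  · rintro Q (rfl | rfl)
    · change Q.1 ≤ fJ.1
      rw [hR, hJ]
      exact regularImage_mono f (h.1 (Set.mem_insert _ _))
    · change Q.1 ≤ fJ.1
      rw [hS, hJ]
      exact regularImage_mono f (h.1 (Set.mem_insert_of_mem _ rfl))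
  · intro T hT
    have hRT : fR.1 ≤ T.1 := hT (Set.mem_insert _ _)
    have hST : fS.1 ≤ T.1 := hT (Set.mem_insert_of_mem _ rfl)
    change fJ.1 ≤ T.1
    rw [← kernelPair_quotientMap T] at hRT hST ⊢
    rw [hR, regularImage_le_kernelPair_iff] at hRT
    rw [hS, regularImage_le_kernelPair_iff] at hST
    rw [hJ, regularImage_le_kernelPair_iff]
    apply h.2
    rintro Q (rfl | rfl)
    · exact hRT
    · exact hST

variable (L : ObjectProperty C) [Reflective L.ι]

/-- If the quotient of `X` by `T` lies in `L`, every equivalence relation contained in `T` has its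
closure contained in `T`. -/
theorem closure_le_of_le {X : C} {R T : EquivRel X} (h : R ≤ T)
    (hT : L (coequalizer (proj₁ T.1) (proj₂ T.1))) : closure L R ≤ T := by
  rw [← kernelPair_quotientMap T, ← kernelPair_quotientMap R] at h
  obtain ⟨k, hk⟩ := exists_desc_of_kernelPair_le _ _ h
  let g := ((reflectorAdjunction L.ι).homEquiv _ ⟨_, hT⟩).symm k
  have hg : (reflectorAdjunction L.ι).unit.app _ ≫ L.ι.map g = k := by
    simpa [g] using ((reflectorAdjunction L.ι).homEquiv_unit (f := g)).symm
  have w := rel_kernelPair_iff.1 (rel_proj (closure L R).1)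
  have w' := congrArg (· ≫ L.ι.map g) w
  refine le_of_rel_proj ?_
  rw [← kernelPair_quotientMap T, rel_kernelPair_iff, ← hk, ← hg]
  simpa using w'

theorem le_closure {X : C} (R : EquivRel X) : R ≤ closure L R :=
  le_kernelPair_iff.2 (by rw [coequalizer.condition_assoc])

/-- Naturality of the unit at the induced map of quotients `k` factors the map defining one closure
through the other. -/
theorem closure_mono {X : C} {R S : EquivRel X} (h : R ≤ S) : closure L R ≤ closure L S := by
  rw [← kernelPair_quotientMap S, ← kernelPair_quotientMap R] at h
  obtain ⟨k, hk⟩ := exists_desc_of_kernelPair_le _ _ h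
  have w := rel_kernelPair_iff.1 (rel_proj (closure L R).1)
  have w' := congrArg (· ≫ L.ι.map ((reflector L.ι).map k)) w
  refine le_of_rel_proj (rel_kernelPair_iff.2 ?_)
  have nat := (reflectorAdjunction L.ι).unit.naturality k
  simp only [Functor.id_map, Functor.comp_map] at nat
  have hk' : quotientMap S ≫ (reflectorAdjunction L.ι).unit.app _ =
      (quotientMap R ≫ (reflectorAdjunction L.ι).unit.app _) ≫
        L.ι.map ((reflector L.ι).map k) := by
    rw [← hk, Category.assoc, Category.assoc]
    exact congrArg _ nat
  rw [hk']
  simpa only [Category.assoc] using w'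

variable {L}

/-- For a Birkhoff subcategory, the quotient by an equivalence relation containing a closure lies
in the subcategory. -/
theorem IsBirkhoff.quotient_of_closure_le (hL : IsBirkhoff L) {X : C} {R T : EquivRel X}
    (h : closure L R ≤ T) : L (coequalizer (proj₁ T.1) (proj₂ T.1)) := by
  have := hL.unit_regularEpi (coequalizer (proj₁ R.1) (proj₂ R.1))
  let p := quotientMap R ≫
    (reflectorAdjunction L.ι).unit.app (coequalizer (proj₁ R.1) (proj₂ R.1))
  have : StrongEpi ((reflectorAdjunction L.ι).unit.app
      (coequalizer (proj₁ R.1) (proj₂ R.1))) := inferInstance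
  have : StrongEpi p := strongEpi_comp _ _
  have := isRegularEpi_of_strongEpi p
  rw [← kernelPair_quotientMap T] at h
  obtain ⟨k, hk⟩ := exists_desc_of_kernelPair_le p (quotientMap T) h
  -- `k` inherits strength from the quotient map `p ≫ k`, so it exhibits `X/T` as a regular quotient
  -- of the reflection of `X/R`.
  have : StrongEpi (p ≫ k) := by
    rw [hk]
    infer_instance
  have := strongEpi_of_strongEpi p k
  exact hL.quotient k (isRegularEpi_of_strongEpi k) ((reflector L.ι).obj _).property

/-- The closure associated with a Birkhoff subcategory preserves joins. -/
theorem IsBirkhoff.isLUB_closure (hL : IsBirkhoff L) {X : C} {R S J : EquivRel X}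
    (h : IsLUB {R, S} J) : IsLUB {closure L R, closure L S} (closure L J) := by
  constructor
  · rintro Q (rfl | rfl)
    · exact closure_mono L (h.1 (Set.mem_insert _ _))
    · exact closure_mono L (h.1 (Set.mem_insert_of_mem _ rfl))
  · intro T hT
    have hR : closure L R ≤ T := hT (Set.mem_insert _ _)
    have hS : closure L S ≤ T := hT (Set.mem_insert_of_mem _ rfl)
    -- One closure below `T` already puts its quotient in `L`; for `S`, only `S ≤ T` is needed.
    refine closure_le_of_le L (h.2 ?_) (hL.quotient_of_closure_le hR)
    rintro Q (rfl | rfl)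
    · exact (le_closure L _).trans hR
    · exact (le_closure L _).trans hS

end Closure

end GoursatClosure

end

theorem mainTheorem5 {C : Type u} [Category.{v} C] [GoursatClosure.Exact C]
    [GoursatClosure.Goursat C] (L : ObjectProperty C) [Reflective L.ι]
    (hL : GoursatClosure.IsBirkhoff L) :
    (∀ {X Y : C} (f : X ⟶ Y), IsRegularEpi f → ∀ R S : GoursatClosure.EquivRel X,
      ∃ (J : GoursatClosure.EquivRel X) (fR fS fJ : GoursatClosure.EquivRel Y),
        IsLUB {R, S} J ∧
        fR.1 = GoursatClosure.regularImage f R.1 ∧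
        fS.1 = GoursatClosure.regularImage f S.1 ∧
        fJ.1 = GoursatClosure.regularImage f J.1 ∧
        IsLUB {GoursatClosure.closure L fR, GoursatClosure.closure L fS}
          (GoursatClosure.closure L fJ)) ∧
    (∀ {X : C} (R S : GoursatClosure.EquivRel X),
      ∃ J : GoursatClosure.EquivRel X, IsLUB {R, S} J ∧
        IsLUB {GoursatClosure.closure L R, GoursatClosure.closure L S}
          (GoursatClosure.closure L J)) := by
  refine ⟨fun {X Y} f _ R S => ?_, fun R S => ?_⟩
  · obtain ⟨J, hJ⟩ := GoursatClosure.exists_isLUB R S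
    exact ⟨J, ⟨_, GoursatClosure.isEquivalenceRelation_regularImage f R⟩,
      ⟨_, GoursatClosure.isEquivalenceRelation_regularImage f S⟩,
      ⟨_, GoursatClosure.isEquivalenceRelation_regularImage f J⟩, hJ, rfl, rfl, rfl,
      hL.isLUB_closure (GoursatClosure.isLUB_regularImage f hJ rfl rfl rfl)⟩
  · obtain ⟨J, hJ⟩ := GoursatClosure.exists_isLUB R S
    exact ⟨J, hJ, hL.isLUB_closure hJ⟩
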